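/- **Conventions.** Alphabets are finite (possibly empty). $A^*$ is the free monoid on $A$, with the distance $d(u,v)=2^{-r(u,v)}$ for $u\neq v$, $d(u,u)=0$, where $r(u,v)$ is the least cardinality of a finite monoid $M$ such that some morphism $A^*\to M$ takes different values at $u$ and $v$; $\widehat{A^*}$ is its completion. A morphism $\phi$ from $A^*$ to a finite (discrete) monoid, or to a free monoid $B^*$, has a unique continuous extension $\hat\phi$ to $\widehat{A^*}$, with values in that monoid or in $\widehat{B^*}$. An ordered monoid is a monoid with a partial order compatible with multiplication. A *stamp* is a morphism from some $A^*$ onto a finite monoid. $\mathcal C$ denotes a class of morphisms between finitely generated free monoids that is closed under composition and contains all length-preserving morphisms. *Pseudovarieties.* A *pseudovariety* is a class of finite monoids closed under finite direct products (including the empty product, the trivial monoid) and division (quotients of submonoids). An *ordered pseudovariety* is a class of finite ordered monoids closed under finite direct products (including the empty one) with the componentwise order, and under division: submonoids with the induced order, and images under order-preserving surjective morphisms. A *$\mathcal C$-pseudovariety* is a class $\mathbf V$ of stamps such that: (i) if $\phi:A^*\to M$ is in $\mathbf V$, $\psi:B^*\to A^*$ is in $\mathcal C$ and $\eta$ is a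 morphism from $\mathrm{Im}(\phi\psi)$ onto a finite monoid $N$, then $\eta\phi\psi:B^*\to N$ is in $\mathbf V$; (ii) if $\phi_i:A^*\to M_i$ $(i=1,2)$ are in $\mathbf V$, then so is $\phi_1\times\phi_2:A^*\to \mathrm{Im}(\phi_1\times\phi_2)$; (iii) for each $A$ the trivial stamp $A^*\to\{1\}$ (the empty product) is in $\mathbf V$. *Varieties of languages.* A class $\mathcal V$ of regular languages assigns to each finite alphabet $A$ a set $A^*\mathcal V$ of regular languages in $A^*$. It is a *positive $\mathcal C$-variety* (resp. a *$\mathcal C$-variety*) if each $A^*\mathcal V$ contains $\emptyset$ and $A^*$, is closed under finite unions and intersections (resp. and also complements), and under the quotients $v^{-1}L=\{w: vw\in L\}$ and $Lv^{-1}=\{w: wv\in L\}$ for $v\in A^*$, and if $\phi^{-1}(L)\in A^*\mathcal V$ whenever $\phi:A^*\to B^*$ is in $\mathcal C$ and $L\in B^*\mathcal V$. The prefix $\mathcal C$ is dropped when $\mathcal C$ consists of all morphisms. *Correspondence.* $\mathrm{Synt}(L)$ is the syntactic monoid of $L$, $\eta_L:A^*\to\mathrm{Synt}(L)$ the syntactic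 morphism, and $\mathrm{Synt}(L)$ is ordered by $m_1\le_L m_2$ iff, for all $s,t\in \mathrm{Synt}(L)$, $sm_2t\in\eta_L(L)$ implies $sm_1t\in\eta_L(L)$. For a class $\mathbf V$ of finite monoids (finite ordered monoids, stamps), $\mathbf V\mapsto\mathcal V$ means: $A^*\mathcal V$ is the set of regular $L\subseteq A^*$ with $\mathrm{Synt}(L)\in\mathbf V$ (resp. $(\mathrm{Synt}(L),\le_L)\in\mathbf V$, $\eta_L\in\mathbf V$). *Identities.* A profinite identity $u=v$ (or ordered identity $u\le v$) is given by $u,v\in\widehat{X^*}$ for some finite alphabet $X$. A finite monoid (ordered monoid) $M$ satisfies it if $\hat\phi(u)=\hat\phi(v)$ (resp. $\hat\phi(u)\le\hat\phi(v)$) for every morphism $\phi:X^*\to M$. A stamp $\phi:A^*\to M$ $\mathcal C$-satisfies $u=v$ if $\hat\phi\hat\psi(u)=\hat\phi\hat\psi(v)$ for every $\psi:X^*\to A^*$ in $\mathcal C$. A class of finite monoids or finite ordered monoids is defined by a set $E$ of identities, and a class of stamps is $\mathcal C$-defined by $E$, if it consists of exactly the finite monoids or finite ordered monoids that satisfy,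 respectively the stamps that $\mathcal C$-satisfy, all members of $E$. **Theorem 2.15.** 1. (Eilenberg) The assignment $\mathbf V\mapsto\mathcal V$ is a bijection from pseudovarieties of finite monoids onto varieties of languages; for every $\mathcal C$ as above, from $\mathcal C$-pseudovarieties of stamps onto $\mathcal C$-varieties of languages; and from ordered pseudovarieties of finite ordered monoids onto positive varieties of languages. 2. (Reiterman) A class of finite monoids is a pseudovariety if and only if it is defined by a set of profinite identities $u=v$; for every $\mathcal C$ as above, a class of stamps is a $\mathcal C$-pseudovariety if and only if it is $\mathcal C$-defined by a set of profinite identities $u=v$; a class of finite ordered monoids is an ordered pseudovariety if and only if it is defined by a set of profinite ordered identities $u\le v$. -/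

import Mathlib

universe u

namespace Eilenberg

/-! ### The profinite metric on `A*` and its completion -/

/-- The finite monoid `M` separates the words `x` and `y`: some morphism `A* → M` takes different
values at `x` and `y`. -/
def Separates {A : Type u} (M : Type u) [Monoid M] (x y : FreeMonoid A) : Prop :=
  ∃ φ : FreeMonoid A →* M, φ x ≠ φ y

/-- The cardinalities of the finite monoids that separate `x` and `y`. -/
def sepCards {A : Type u} (x y : FreeMonoid A) : Set ℕ :=
  {n | ∃ (M : Type u) (_ : Monoid M) (_ : Finite M), Nat.card M = n ∧ Separates M x y}

/-- `r(x, y)`: the least cardinality of a finite monoid that separates `x` and `y`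
(meaningful for `x ≠ y`, see `sepCards_nonempty`). -/
noncomputable def sepIndex {A : Type u} (x y : FreeMonoid A) : ℕ := sInf (sepCards x y)

/-- The action of the free monoid on lists of length at most `n` in which a letter is prepended
when there is room for it. -/
noncomputable def boundedAction (A : Type u) (n : ℕ) :
    FreeMonoid A →* Function.End {l : List A // l.length ≤ n} :=
  FreeMonoid.lift fun a l => if h : l.1.length < n then ⟨a :: l.1, by simpa using h⟩ else l

theorem boundedAction_apply {A : Type u} (n : ℕ) (w : List A) (hw : w.length ≤ n) :
    (boundedAction A n (FreeMonoid.ofList w) ⟨[], Nat.zero_le n⟩).1 = w := by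
  induction w with
  | nil => rw [FreeMonoid.ofList_nil, map_one]; rfl
  | cons a w ih =>
    have hw' : w.length < n := by simpa using hw
    have h := ih hw'.le
    rw [FreeMonoid.ofList_cons, map_mul]
    change (boundedAction A n (FreeMonoid.of a)
      (boundedAction A n (FreeMonoid.ofList w) ⟨[], Nat.zero_le n⟩)).1 = a :: w
    generalize boundedAction A n (FreeMonoid.ofList w) ⟨[], Nat.zero_le n⟩ = l at h
    obtain ⟨l, hl⟩ := l
    subst h
    change (boundedAction A n (FreeMonoid.of a) ⟨l, hl⟩).1 = a :: l
    have e : boundedAction A n (FreeMonoid.of a) = fun l : {l : List A // l.length ≤ n} =>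
        if h : l.1.length < n then ⟨a :: l.1, by simpa using h⟩ else l :=
      FreeMonoid.lift_eval_of _ _
    rw [e]
    exact congrArg Subtype.val (dif_pos hw')

theorem sepCards_comm {A : Type u} {x y : FreeMonoid A} : sepCards x y = sepCards y x := by
  ext n
  simp only [sepCards, Separates, Set.mem_ofPred_eq, ne_comm]

/-- Distinct words over a finite alphabet are separated by a finite monoid. -/
theorem sepCards_nonempty {A : Type u} [Finite A] {x y : FreeMonoid A} (h : x ≠ y) :
    (sepCards x y).Nonempty := by
  let n := max x.toList.length y.toList.length
  have : Finite {l : List A // l.length ≤ n} := (List.finite_length_le A n).to_subtype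
  have : Finite (Function.End {l : List A // l.length ≤ n}) :=
    inferInstanceAs (Finite ({l : List A // l.length ≤ n} → {l : List A // l.length ≤ n}))
  refine ⟨_, Function.End {l : List A // l.length ≤ n}, inferInstance, inferInstance, rfl,
    boundedAction A n, fun e => h ?_⟩
  have hx := boundedAction_apply n x.toList (le_max_left _ _)
  have hy := boundedAction_apply n y.toList (le_max_right _ _)
  rw [FreeMonoid.ofList_toList] at hx hy
  rw [e] at hx
  exact FreeMonoid.toList.injective (hx.symm.trans hy)

open Classical in
/-- The profinite distance on `A*`: `d(x, y) = 2 ^ (-r(x, y))` if `x ≠ y`, and `d(x, x) = 0`. -/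
noncomputable def profiniteDist {A : Type u} (x y : FreeMonoid A) : ℝ :=
  if x = y then 0 else (2 : ℝ)⁻¹ ^ sepIndex x y

theorem profiniteDist_le_max {A : Type u} [Finite A] (x y z : FreeMonoid A) :
    profiniteDist x z ≤ max (profiniteDist x y) (profiniteDist y z) := by
  have hnn : ∀ a b : FreeMonoid A, 0 ≤ profiniteDist a b := fun a b => by
    unfold profiniteDist; split_ifs <;> positivity
  by_cases hxz : x = z
  · rw [profiniteDist, if_pos hxz]; exact le_max_of_le_left (hnn _ _)
  obtain ⟨M, _, _, hM, φ, hφ⟩ := Nat.sInf_mem (sepCards_nonempty hxz)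
  have key : ∀ a b : FreeMonoid A, φ a ≠ φ b → profiniteDist x z ≤ profiniteDist a b := by
    intro a b hab
    have hab' : a ≠ b := fun e => hab (by rw [e])
    rw [profiniteDist, profiniteDist, if_neg hxz, if_neg hab']
    exact pow_le_pow_of_le_one (by norm_num) (by norm_num)
      (Nat.sInf_le ⟨M, _, ‹_›, hM, φ, hab⟩)
  by_cases hxy : φ x = φ y
  · exact le_max_of_le_right (key y z fun e => hφ (hxy.trans e))
  · exact le_max_of_le_left (key x y hxy)

/-- `A*` with the profinite distance. -/
noncomputable instance (A : Type u) [Finite A] : MetricSpace (FreeMonoid A) where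
  dist := profiniteDist
  dist_self x := by simp [profiniteDist]
  dist_comm x y := by
    by_cases h : x = y
    · rw [h]
    · rw [profiniteDist, profiniteDist, if_neg h, if_neg (Ne.symm h), sepIndex, sepIndex,
        sepCards_comm]
  dist_triangle x y z := by
    have hnn : ∀ a b : FreeMonoid A, 0 ≤ profiniteDist a b := fun a b => by
      unfold profiniteDist; split_ifs <;> positivity
    refine (profiniteDist_le_max x y z).trans (max_le ?_ ?_)
    · linarith [hnn y z]
    · linarith [hnn x y]
  eq_of_dist_eq_zero {x y} h := by
    by_contra hne
    have h' : profiniteDist x y = 0 := h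
    rw [profiniteDist, if_neg hne] at h'
    exact absurd h' (by positivity)

/-- The completion of `A*` for the profinite distance, that is, (the underlying space of) the free
profinite monoid on `A`. -/
abbrev FreeProfinite (A : Type u) [Finite A] : Type u := UniformSpace.Completion (FreeMonoid A)

/-- A morphism from `A*` to a finite discrete monoid is uniformly continuous. -/
theorem uniformContinuous_of_finite {A M : Type u} [Finite A] [Monoid M] [Finite M]
    (φ : FreeMonoid A →* M) : @UniformContinuous _ _ _ ⊥ φ := by
  let _ : UniformSpace M := ⊥
  have : DiscreteUniformity M := ⟨rfl⟩
  rw [UniformContinuous, DiscreteUniformity.eq_principal_setRelId (X := M), Filter.tendsto_principal,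
    Metric.uniformity_basis_dist.eventually_iff]
  refine ⟨(2 : ℝ)⁻¹ ^ Nat.card M, by positivity, fun {p} hp => ?_⟩
  by_contra hne
  have hne' : φ p.1 ≠ φ p.2 := hne
  have hp' : profiniteDist p.1 p.2 < (2 : ℝ)⁻¹ ^ Nat.card M := hp
  rw [profiniteDist, if_neg fun e => hne' (by rw [e])] at hp'
  refine absurd hp' (not_lt.mpr (pow_le_pow_of_le_one (by norm_num) (by norm_num) ?_))
  exact Nat.sInf_le ⟨M, _, ‹_›, rfl, φ, hne'⟩

/-- A morphism between free monoids is uniformly continuous for the profinite distances. -/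
theorem uniformContinuous_freeMonoid {A B : Type u} [Finite A] [Finite B]
    (ψ : FreeMonoid A →* FreeMonoid B) : UniformContinuous ψ := by
  refine (LipschitzWith.of_dist_le_mul (K := 1) fun x y => ?_).uniformContinuous
  rw [NNReal.coe_one, one_mul]
  change profiniteDist (ψ x) (ψ y) ≤ profiniteDist x y
  by_cases h : ψ x = ψ y
  · rw [profiniteDist, if_pos h, profiniteDist]; split_ifs <;> positivity
  rw [profiniteDist, profiniteDist, if_neg h, if_neg fun e => h (by rw [e])]
  refine pow_le_pow_of_le_one (by norm_num) (by norm_num) ?_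
  obtain ⟨M, _, _, hM, φ, hφ⟩ := Nat.sInf_mem (sepCards_nonempty h)
  exact Nat.sInf_le ⟨M, _, ‹_›, hM, φ.comp ψ, hφ⟩

/-- The continuous extension `φ̂` to the profinite completion of a morphism `φ` from `A*` to a
finite monoid with the discrete uniformity. -/
noncomputable def hat {A M : Type u} [Finite A] [Monoid M] [Finite M] (φ : FreeMonoid A →* M) :
    FreeProfinite A → M :=
  letI : UniformSpace M := ⊥
  UniformSpace.Completion.extension φ

/-- The continuous extension `ψ̂` to the profinite completions of a morphism `ψ : A* → B*`. -/
noncomputable def hatMap {A B : Type u} [Finite A] [Finite B] (ψ : FreeMonoid A →* FreeMonoid B) :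
    FreeProfinite A → FreeProfinite B :=
  UniformSpace.Completion.map ψ

theorem hat_coe {A M : Type u} [Finite A] [Monoid M] [Finite M] (φ : FreeMonoid A →* M)
    (w : FreeMonoid A) : hat φ (w : FreeProfinite A) = φ w := by
  let _ : UniformSpace M := ⊥
  have : DiscreteUniformity M := ⟨rfl⟩
  exact UniformSpace.Completion.extension_coe (uniformContinuous_of_finite φ) w

theorem continuous_hat {A M : Type u} [Finite A] [Monoid M] [Finite M] (φ : FreeMonoid A →* M) :
    @Continuous _ _ _ ⊥ (hat φ) := by
  let _ : UniformSpace M := ⊥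
  have : DiscreteUniformity M := ⟨rfl⟩
  exact UniformSpace.Completion.continuous_extension

theorem hatMap_coe {A B : Type u} [Finite A] [Finite B] (ψ : FreeMonoid A →* FreeMonoid B)
    (w : FreeMonoid A) : hatMap ψ (w : FreeProfinite A) = (ψ w : FreeProfinite B) :=
  UniformSpace.Completion.map_coe (uniformContinuous_freeMonoid ψ) w

/-! ### Regular languages, classes of morphisms, varieties of languages -/

/-- A set of words is regular if it is accepted by a finite automaton. -/
def IsRegularSet {A : Type u} (L : Set (FreeMonoid A)) : Prop :=
  Language.IsRegular (FreeMonoid.ofList ⁻¹' L : Set (List A))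

/-- A class of regular languages: a set `A*𝒱` of regular languages over each finite alphabet `A`. -/
@[ext]
structure LanguageClass where
  langs : ∀ (A : Type u) [Finite A], Set (Set (FreeMonoid A))
  regular : ∀ (A : Type u) [Finite A], ∀ L ∈ langs A, IsRegularSet L

/-- A class of morphisms between finitely generated free monoids. -/
abbrev MorphismClass := ∀ (A B : Type u) [Finite A] [Finite B], Set (FreeMonoid A →* FreeMonoid B)

/-- The class of all morphisms between finitely generated free monoids. -/
def allMorphisms : MorphismClass.{u} := fun _ _ _ _ => Set.univ

/-- The class is closed under composition and contains all length-preserving morphisms. -/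
structure MorphismClass.IsAdmissible (C : MorphismClass.{u}) : Prop where
  comp_mem : ∀ {A B D : Type u} [Finite A] [Finite B] [Finite D]
    (ψ : FreeMonoid B →* FreeMonoid D) (φ : FreeMonoid A →* FreeMonoid B),
    ψ ∈ C B D → φ ∈ C A B → ψ.comp φ ∈ C A D
  length_preserving_mem : ∀ {A B : Type u} [Finite A] [Finite B]
    (φ : FreeMonoid A →* FreeMonoid B), (∀ w, (φ w).length = w.length) → φ ∈ C A B

/-- Positive `C`-varieties of languages: lattices of languages (containing `∅` and `A*`), closed
under quotients and under inverse images along morphisms in `C`. -/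
structure IsPositiveCVariety (C : MorphismClass.{u}) (𝒱 : LanguageClass.{u}) : Prop where
  empty_mem : ∀ (A : Type u) [Finite A], ∅ ∈ 𝒱.langs A
  univ_mem : ∀ (A : Type u) [Finite A], Set.univ ∈ 𝒱.langs A
  union_mem : ∀ (A : Type u) [Finite A], ∀ K ∈ 𝒱.langs A, ∀ L ∈ 𝒱.langs A, K ∪ L ∈ 𝒱.langs A
  inter_mem : ∀ (A : Type u) [Finite A], ∀ K ∈ 𝒱.langs A, ∀ L ∈ 𝒱.langs A, K ∩ L ∈ 𝒱.langs A
  left_quotient_mem : ∀ (A : Type u) [Finite A], ∀ L ∈ 𝒱.langs A, ∀ v : FreeMonoid A,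
    {w | v * w ∈ L} ∈ 𝒱.langs A
  right_quotient_mem : ∀ (A : Type u) [Finite A], ∀ L ∈ 𝒱.langs A, ∀ v : FreeMonoid A,
    {w | w * v ∈ L} ∈ 𝒱.langs A
  preimage_mem : ∀ (A B : Type u) [Finite A] [Finite B], ∀ φ ∈ C A B, ∀ L ∈ 𝒱.langs B,
    φ ⁻¹' L ∈ 𝒱.langs A

/-- `C`-varieties of languages: as above, with boolean algebras instead of lattices. -/
structure IsCVariety (C : MorphismClass.{u}) (𝒱 : LanguageClass.{u}) : Prop
    extends IsPositiveCVariety C 𝒱 where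
  compl_mem : ∀ (A : Type u) [Finite A], ∀ L ∈ 𝒱.langs A, Lᶜ ∈ 𝒱.langs A

/-- Varieties of languages. -/
def IsVariety (𝒱 : LanguageClass.{u}) : Prop := IsCVariety allMorphisms 𝒱

/-- Positive varieties of languages. -/
def IsPositiveVariety (𝒱 : LanguageClass.{u}) : Prop := IsPositiveCVariety allMorphisms 𝒱

/-! ### Syntactic monoids -/

/-- The syntactic congruence of `L`. -/
def syntacticCon {A : Type u} (L : Set (FreeMonoid A)) : Con (FreeMonoid A) where
  r x y := ∀ s t, s * x * t ∈ L ↔ s * y * t ∈ L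
  iseqv := ⟨fun _ _ _ => Iff.rfl, fun h s t => (h s t).symm, fun h k s t => (h s t).trans (k s t)⟩
  mul' {w x y z} h k s t := by
    have h' := h s (y * t)
    have k' := k (s * x) t
    simp only [mul_assoc] at h' k' ⊢
    exact h'.trans k'

/-- The syntactic monoid of `L`. -/
abbrev Synt {A : Type u} (L : Set (FreeMonoid A)) : Type u := (syntacticCon L).Quotient

/-- The syntactic morphism `η_L`. -/
def syntacticHom {A : Type u} (L : Set (FreeMonoid A)) : FreeMonoid A →* Synt L :=
  (syntacticCon L).mk'

theorem syntacticHom_surjective {A : Type u} (L : Set (FreeMonoid A)) :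
    Function.Surjective (syntacticHom L) := Con.mk'_surjective

theorem syntacticHom_mem_image {A : Type u} (L : Set (FreeMonoid A)) (w : FreeMonoid A) :
    syntacticHom L w ∈ syntacticHom L '' L ↔ w ∈ L := by
  refine ⟨fun ⟨v, hv, e⟩ => ?_, fun h => ⟨w, h, rfl⟩⟩
  have h := (Con.eq (syntacticCon L)).mp e 1 1
  simpa using h.mp (by simpa using hv)

/-- The syntactic order: `m₁ ≤ m₂` if `s m₂ t ∈ η(L)` implies `s m₁ t ∈ η(L)` for all `s`, `t`. -/
instance {A : Type u} (L : Set (FreeMonoid A)) : PartialOrder (Synt L) where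
  le m₁ m₂ := ∀ s t : Synt L,
    s * m₂ * t ∈ syntacticHom L '' L → s * m₁ * t ∈ syntacticHom L '' L
  le_refl _ _ _ h := h
  le_trans _ _ _ h k s t := fun e => h s t (k s t e)
  le_antisymm m₁ m₂ h k := by
    obtain ⟨x, rfl⟩ := syntacticHom_surjective L m₁
    obtain ⟨y, rfl⟩ := syntacticHom_surjective L m₂
    refine (Con.eq (syntacticCon L)).mpr fun s t => ?_
    have h' := h (syntacticHom L s) (syntacticHom L t)
    have k' := k (syntacticHom L s) (syntacticHom L t)
    simp only [← map_mul, syntacticHom_mem_image] at h' k'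
    exact ⟨k', h'⟩

theorem synt_mul_le_mul {A : Type u} (L : Set (FreeMonoid A)) (a b c d : Synt L)
    (hab : a ≤ b) (hcd : c ≤ d) : a * c ≤ b * d := by
  intro s t h
  have h₁ := hcd (s * b) t (by simpa only [mul_assoc] using h)
  simpa only [mul_assoc] using hab s (c * t) (by simpa only [mul_assoc] using h₁)

/-! ### Finite monoids, finite ordered monoids, stamps -/

/-- A finite monoid. -/
structure FinMonoid where
  carrier : Type u
  [monoid : Monoid carrier]
  [finite : Finite carrier]

/-- A finite monoid with a partial order compatible with multiplication. -/
structure FinOrdMonoid where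
  carrier : Type u
  [monoid : Monoid carrier]
  [finite : Finite carrier]
  [order : PartialOrder carrier]
  mul_le_mul : ∀ a b c d : carrier, a ≤ b → c ≤ d → a * c ≤ b * d

/-- A stamp over the alphabet `A`: a morphism from `A*` onto a finite monoid. -/
structure Stamp (A : Type u) where
  carrier : Type u
  [monoid : Monoid carrier]
  [finite : Finite carrier]
  hom : FreeMonoid A →* carrier
  surjective : Function.Surjective hom

attribute [instance] FinMonoid.monoid FinMonoid.finite FinOrdMonoid.monoid FinOrdMonoid.finite
  FinOrdMonoid.order Stamp.monoid Stamp.finite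

/-- A class of stamps (over arbitrary finite alphabets). -/
abbrev StampClass := ∀ (A : Type u) [Finite A], Set (Stamp A)

/-- The trivial monoid. -/
abbrev FinMonoid.trivial : FinMonoid.{u} := ⟨PUnit⟩

/-- The direct product of two finite monoids. -/
abbrev FinMonoid.prod (M N : FinMonoid.{u}) : FinMonoid.{u} := ⟨M.carrier × N.carrier⟩

/-- `M` divides `N`: it is a quotient of a submonoid of `N`. -/
def FinMonoid.Divides (M N : FinMonoid.{u}) : Prop :=
  ∃ (S : Submonoid N.carrier) (f : S →* M.carrier), Function.Surjective f

/-- The trivial ordered monoid. -/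
abbrev FinOrdMonoid.trivial : FinOrdMonoid.{u} := ⟨PUnit, fun _ _ _ _ _ _ => le_rfl⟩

/-- The direct product of two finite ordered monoids, with the componentwise order. -/
abbrev FinOrdMonoid.prod (M N : FinOrdMonoid.{u}) : FinOrdMonoid.{u} :=
  ⟨M.carrier × N.carrier, fun _ _ _ _ h k => Prod.mk_le_mk.mpr
    ⟨M.mul_le_mul _ _ _ _ h.1 k.1, N.mul_le_mul _ _ _ _ h.2 k.2⟩⟩

/-- `M` divides `N` as an ordered monoid: it is the image of a submonoid of `N`, with the order
induced by `N`, under an order-preserving morphism. -/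
def FinOrdMonoid.Divides (M N : FinOrdMonoid.{u}) : Prop :=
  ∃ (S : Submonoid N.carrier) (f : S →* M.carrier), Function.Surjective f ∧ Monotone f

/-- The trivial stamp over `A`. -/
abbrev Stamp.trivial (A : Type u) : Stamp A := ⟨PUnit, 1, fun _ => ⟨1, rfl⟩⟩

/-- The product of two stamps over `A`: the morphism `w ↦ (φ₁ w, φ₂ w)` onto its image. -/
abbrev Stamp.prod {A : Type u} (φ₁ φ₂ : Stamp A) : Stamp A :=
  ⟨MonoidHom.mrange (φ₁.hom.prod φ₂.hom), (φ₁.hom.prod φ₂.hom).mrangeRestrict,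
    MonoidHom.mrangeRestrict_surjective _⟩

/-- For a stamp `φ` over `A`, a morphism `ψ : B* → A*` and a morphism `η` from the image of `φ ψ`
onto a finite monoid `N`, the stamp `η φ ψ : B* → N`. -/
abbrev Stamp.pull {A B : Type u} (φ : Stamp A) (ψ : FreeMonoid B →* FreeMonoid A) (N : FinMonoid.{u})
    (η : MonoidHom.mrange (φ.hom.comp ψ) →* N.carrier) (hη : Function.Surjective η) : Stamp B :=
  ⟨N.carrier, η.comp (φ.hom.comp ψ).mrangeRestrict,
    hη.comp (MonoidHom.mrangeRestrict_surjective _)⟩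

/-! ### Pseudovarieties -/

/-- Pseudovarieties of finite monoids: classes closed under division and finite direct products
(the trivial monoid is the empty product). -/
structure IsPseudovariety (V : Set FinMonoid.{u}) : Prop where
  trivial_mem : FinMonoid.trivial ∈ V
  prod_mem : ∀ M ∈ V, ∀ N ∈ V, M.prod N ∈ V
  divides_mem : ∀ M N : FinMonoid.{u}, N ∈ V → M.Divides N → M ∈ V

/-- Pseudovarieties of finite ordered monoids. -/
structure IsOrdPseudovariety (V : Set FinOrdMonoid.{u}) : Prop where
  trivial_mem : FinOrdMonoid.trivial ∈ V
  prod_mem : ∀ M ∈ V, ∀ N ∈ V, M.prod N ∈ V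
  divides_mem : ∀ M N : FinOrdMonoid.{u}, N ∈ V → M.Divides N → M ∈ V

/-- `C`-pseudovarieties of stamps (the trivial stamp over `A` is the empty product). -/
structure IsCPseudovariety (C : MorphismClass.{u}) (V : StampClass.{u}) : Prop where
  trivial_mem : ∀ (A : Type u) [Finite A], Stamp.trivial A ∈ V A
  prod_mem : ∀ (A : Type u) [Finite A], ∀ φ₁ ∈ V A, ∀ φ₂ ∈ V A, φ₁.prod φ₂ ∈ V A
  pull_mem : ∀ (A B : Type u) [Finite A] [Finite B], ∀ φ ∈ V A, ∀ ψ ∈ C B A,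
    ∀ (N : FinMonoid.{u}) (η : MonoidHom.mrange (φ.hom.comp ψ) →* N.carrier)
      (hη : Function.Surjective η), φ.pull ψ N η hη ∈ V B

/-! ### The associated classes of languages -/

/-- `L ∈ A*𝒱` iff `L` is regular and its syntactic monoid (which is then finite) is in `V`. -/
def languagesOf (V : Set FinMonoid.{u}) : LanguageClass.{u} where
  langs _ _ := {L | IsRegularSet L ∧ ∃ _ : Finite (Synt L), (⟨Synt L⟩ : FinMonoid) ∈ V}
  regular _ _ _ h := h.1

/-- `L ∈ A*𝒱` iff `L` is regular and its ordered syntactic monoid is in `V`. -/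
def languagesOfOrd (V : Set FinOrdMonoid.{u}) : LanguageClass.{u} where
  langs _ _ := {L | IsRegularSet L ∧
    ∃ _ : Finite (Synt L), (⟨Synt L, synt_mul_le_mul L⟩ : FinOrdMonoid) ∈ V}
  regular _ _ _ h := h.1

/-- `L ∈ A*𝒱` iff `L` is regular and its syntactic morphism is in `V`. -/
def languagesOfStamps (V : StampClass.{u}) : LanguageClass.{u} where
  langs A _ := {L | IsRegularSet L ∧
    ∃ _ : Finite (Synt L), (⟨Synt L, syntacticHom L, syntacticHom_surjective L⟩ : Stamp A) ∈ V A}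
  regular _ _ _ h := h.1

/-! ### Profinite identities -/

/-- A pair `(lhs, rhs)` of elements of the free profinite monoid on a finite alphabet `X`. -/
structure ProfiniteIdentity where
  X : Type u
  [finite : Finite X]
  lhs : FreeProfinite X
  rhs : FreeProfinite X

attribute [instance] ProfiniteIdentity.finite

/-- `M` satisfies the profinite identity `lhs = rhs`. -/
def FinMonoid.Satisfies (M : FinMonoid.{u}) (e : ProfiniteIdentity.{u}) : Prop :=
  ∀ φ : FreeMonoid e.X →* M.carrier, hat φ e.lhs = hat φ e.rhs

/-- `M` satisfies the profinite ordered identity `lhs ≤ rhs`. -/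
def FinOrdMonoid.Satisfies (M : FinOrdMonoid.{u}) (e : ProfiniteIdentity.{u}) : Prop :=
  ∀ φ : FreeMonoid e.X →* M.carrier, hat φ e.lhs ≤ hat φ e.rhs

/-- The stamp `φ` `C`-satisfies the profinite identity `lhs = rhs`. -/
def Stamp.CSatisfies (C : MorphismClass.{u}) {A : Type u} [Finite A] (φ : Stamp A)
    (e : ProfiniteIdentity.{u}) : Prop :=
  ∀ ψ ∈ C e.X A, hat φ.hom (hatMap ψ e.lhs) = hat φ.hom (hatMap ψ e.rhs)

/-- The class of finite monoids defined by a set of profinite identities. -/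
def definedBy (E : Set ProfiniteIdentity.{u}) : Set FinMonoid.{u} :=
  {M | ∀ e ∈ E, M.Satisfies e}

/-- The class of finite ordered monoids defined by a set of profinite ordered identities. -/
def ordDefinedBy (E : Set ProfiniteIdentity.{u}) : Set FinOrdMonoid.{u} :=
  {M | ∀ e ∈ E, M.Satisfies e}

/-- The class of stamps `C`-defined by a set of profinite identities. -/
def cDefinedBy (C : MorphismClass.{u}) (E : Set ProfiniteIdentity.{u}) : StampClass.{u} :=
  fun _ _ => {φ | ∀ e ∈ E, φ.CSatisfies C e}

end Eilenberg

open Eilenberg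

namespace Eilenberg

/-! ### Morphisms from free monoids -/

theorem exists_comp_eq_of_surjective {W M N : Type*} [Monoid W] [Monoid M] [Monoid N]
    (f : W →* M) (hf : Function.Surjective f) (g : W →* N)
    (h : ∀ x y, f x = f y → g x = g y) : ∃ k : M →* N, k.comp f = g := by
  have key : ∀ w, g (Function.surjInv hf (f w)) = g w := fun w =>
    h _ _ (Function.surjInv_eq hf _)
  refine ⟨⟨⟨fun m => g (Function.surjInv hf m), ?_⟩, fun a b => ?_⟩, MonoidHom.ext key⟩
  · simpa using key 1
  · obtain ⟨x, rfl⟩ := hf a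
    obtain ⟨y, rfl⟩ := hf b
    change g (Function.surjInv hf (f x * f y)) = _
    rw [← map_mul, key, map_mul]
    exact congrArg₂ (· * ·) (key x).symm (key y).symm

theorem exists_lift_of_surjective {A : Type*} {M N : Type*} [Monoid M] [Monoid N]
    (f : M →* N) (hf : Function.Surjective f) (φ : FreeMonoid A →* N) :
    ∃ ψ : FreeMonoid A →* M, f.comp ψ = φ :=
  ⟨FreeMonoid.lift fun a => Function.surjInv hf (φ (FreeMonoid.of a)),
    FreeMonoid.hom_eq fun a => by simp [Function.surjInv_eq hf]⟩

/-- The evaluation morphism `M* → M`. -/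
def evalHom (M : Type u) [Monoid M] : FreeMonoid M →* M := FreeMonoid.lift id

theorem evalHom_surjective (M : Type u) [Monoid M] : Function.Surjective (evalHom M) := fun m =>
  ⟨FreeMonoid.of m, FreeMonoid.lift_eval_of _ _⟩

theorem Separates.exists_end {A M : Type u} [Monoid M] [Finite M] {x y : FreeMonoid A} (h : Separates M x y) :
    ∃ θ : A → Function.End (Fin (Nat.card M)), FreeMonoid.lift θ x ≠ FreeMonoid.lift θ y := by
  obtain ⟨φ, hφ⟩ := h
  let e := Finite.equivFin M
  let ρ : M →* Function.End (Fin (Nat.card M)) :=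
    { toFun := fun m i => e (m * e.symm i)
      map_one' := by
        funext i
        exact (by simp : e (1 * e.symm i) = i)
      map_mul' := fun a b => by
        funext i
        exact (by simp [mul_assoc] :
          e (a * b * e.symm i) = e (a * e.symm (e (b * e.symm i)))) }
  have hρ : FreeMonoid.lift (fun a => ρ (φ (FreeMonoid.of a))) = ρ.comp φ :=
    FreeMonoid.hom_eq fun a => by simp
  refine ⟨fun a => ρ (φ (FreeMonoid.of a)), fun hxy => hφ ?_⟩
  rw [hρ] at hxy
  have : e (φ x * e.symm (e 1)) = e (φ y * e.symm (e 1)) := congrFun hxy (e 1)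
  simpa using this

/-! ### Continuous extensions -/

section Profinite

variable {A B M N : Type u} [Finite A] [Finite B] [Monoid M] [Finite M] [Monoid N] [Finite N]

theorem isLocallyConstant_hat (φ : FreeMonoid A →* M) : IsLocallyConstant (hat φ) := by
  let _ : TopologicalSpace M := ⊥
  have : DiscreteTopology M := ⟨rfl⟩
  exact (IsLocallyConstant.iff_continuous _).mpr (continuous_hat φ)

theorem continuous_hatMap (ψ : FreeMonoid A →* FreeMonoid B) : Continuous (hatMap ψ) :=
  UniformSpace.Completion.continuous_map

theorem exists_word_eq {X : Type*} {f : FreeProfinite A → X} (hf : IsLocallyConstant f)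
    (x : FreeProfinite A) : ∃ w : FreeMonoid A, f (w : FreeProfinite A) = f x :=
  UniformSpace.Completion.denseRange_coe.exists_mem_open (hf {f x}) ⟨x, rfl⟩

theorem exists_word_hat_eq (φ : FreeMonoid A →* M) (ψ : FreeMonoid A →* N)
    (x : FreeProfinite A) : ∃ w, hat φ x = φ w ∧ hat ψ x = ψ w := by
  obtain ⟨w, hw⟩ := exists_word_eq ((isLocallyConstant_hat φ).prodMk (isLocallyConstant_hat ψ)) x
  rw [Prod.ext_iff] at hw
  simp only [hat_coe] at hw
  exact ⟨w, hw.1.symm, hw.2.symm⟩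

theorem hat_comp (f : M →* N) (φ : FreeMonoid A →* M) (x : FreeProfinite A) :
    hat (f.comp φ) x = f (hat φ x) := by
  obtain ⟨w, h₁, h₂⟩ := exists_word_hat_eq φ (f.comp φ) x
  rw [h₁, h₂, MonoidHom.comp_apply]

theorem hat_hatMap (φ : FreeMonoid B →* M) (ψ : FreeMonoid A →* FreeMonoid B)
    (x : FreeProfinite A) : hat φ (hatMap ψ x) = hat (φ.comp ψ) x := by
  obtain ⟨w, hw⟩ := exists_word_eq (((isLocallyConstant_hat φ).comp_continuous
    (continuous_hatMap ψ)).prodMk (isLocallyConstant_hat (φ.comp ψ))) x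
  rw [Prod.ext_iff] at hw
  simp only [Function.comp_apply, hatMap_coe, hat_coe, MonoidHom.comp_apply] at hw
  exact hw.1.symm.trans hw.2

theorem hat_eq_of_ker_le {φ : FreeMonoid A →* M} {ψ : FreeMonoid A →* N}
    (h : ∀ v w, φ v = φ w → ψ v = ψ w) {x y : FreeProfinite A} (hxy : hat φ x = hat φ y) :
    hat ψ x = hat ψ y := by
  obtain ⟨v, hv, hv'⟩ := exists_word_hat_eq φ ψ x
  obtain ⟨w, hw, hw'⟩ := exists_word_hat_eq φ ψ y
  rw [hv', hw']
  exact h _ _ (by rw [← hv, ← hw, hxy])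

/-! ### Compactness of the free profinite monoid -/

theorem totallyBounded_freeMonoid (A : Type u) [Finite A] :
    TotallyBounded (Set.univ : Set (FreeMonoid A)) := by
  refine Metric.totallyBounded_of_finite_discretization fun ε hε => ?_
  obtain ⟨n, hn⟩ := exists_pow_lt_of_lt_one hε (show (2 : ℝ)⁻¹ < 1 by norm_num)
  have (k : ℕ) : Finite (Function.End (Fin k)) := inferInstanceAs (Finite (Fin k → Fin k))
  refine ⟨∀ k : Fin n, (A → Function.End (Fin k)) → Function.End (Fin k), Fintype.ofFinite _,
    fun x k θ => FreeMonoid.lift θ x.1, fun ⟨x, _⟩ ⟨y, _⟩ hxy => ?_⟩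
  by_cases hne : x = y
  · simpa [hne] using hε
  refine lt_of_le_of_lt ?_ hn
  change profiniteDist x y ≤ _
  rw [profiniteDist, if_neg hne]
  refine pow_le_pow_of_le_one (by norm_num) (by norm_num) ?_
  by_contra! hlt
  obtain ⟨M, _, _, hM, hsep⟩ := Nat.sInf_mem (sepCards_nonempty hne)
  obtain ⟨θ, hθ⟩ := hsep.exists_end
  have hlt' : Nat.card M < n := by rw [hM]; exact hlt
  exact hθ (congrFun (congrFun hxy ⟨Nat.card M, hlt'⟩) θ)

instance (A : Type u) [Finite A] : CompactSpace (FreeProfinite A) := by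
  refine ⟨?_⟩
  have h : TotallyBounded (Set.range ((↑) : FreeMonoid A → FreeProfinite A)) := by
    rw [← Set.image_univ]
    exact (totallyBounded_freeMonoid A).image (UniformSpace.Completion.uniformContinuous_coe _)
  have := h.closure.isCompact_of_isClosed isClosed_closure
  rwa [UniformSpace.Completion.denseRange_coe.closure_range] at this

/-- A directed family of closed relations on a free profinite monoid has a common point. -/
theorem exists_common_pair {ι : Type*} [Nonempty ι]
    (R : ι → FreeProfinite A × FreeProfinite A → Prop)
    (hclosed : ∀ i, IsLocallyConstant (R i)) (hne : ∀ i, ∃ p, R i p)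
    (hdir : ∀ i j, ∃ k, ∀ p, R k p → R i p ∧ R j p) : ∃ p, ∀ i, R i p := by
  have hc : ∀ i, IsClosed {p | R i p} := fun i => by
    have := (hclosed i).isClosed_fiber True
    simpa using this
  obtain ⟨p, hp⟩ := IsCompact.nonempty_iInter_of_directed_nonempty_isCompact_isClosed
    (fun i => {p | R i p})
    (fun i j => (hdir i j).imp fun k hk => ⟨fun p hp => (hk p hp).1, fun p hp => (hk p hp).2⟩)
    hne (fun i => (hc i).isCompact) hc
  exact ⟨p, Set.mem_iInter.mp hp⟩

end Profinite

/-! ### Recognition by finite monoids -/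

section Recognition

variable {A : Type u}

theorem preimage_image_syntacticHom (L : Set (FreeMonoid A)) :
    syntacticHom L ⁻¹' (syntacticHom L '' L) = L :=
  Set.ext fun w => syntacticHom_mem_image L w

theorem syntacticHom_preimage_eq {M : Type*} [Monoid M] (φ : FreeMonoid A →* M) (P : Set M)
    {v w : FreeMonoid A} (h : φ v = φ w) :
    syntacticHom (φ ⁻¹' P) v = syntacticHom (φ ⁻¹' P) w :=
  (Con.eq _).mpr fun s t => by simp only [Set.mem_preimage, map_mul, h]

theorem isRegularSet_preimage {M : Type*} [Monoid M] [Finite M] (φ : FreeMonoid A →* M)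
    (P : Set M) : IsRegularSet (φ ⁻¹' P) := by
  let D : DFA A M := ⟨fun m a => m * φ (FreeMonoid.of a), 1, P⟩
  have hD : ∀ (w : List A) (m : M), D.evalFrom m w = m * φ (FreeMonoid.ofList w) := by
    intro w
    induction w with
    | nil => intro m; rw [FreeMonoid.ofList_nil, map_one, mul_one]; rfl
    | cons a w ih =>
      intro m
      rw [DFA.evalFrom_cons, ih, FreeMonoid.ofList_cons, map_mul, ← mul_assoc]
  refine Language.isRegular_iff.mpr ⟨M, Fintype.ofFinite M, D, Set.ext fun w => ?_⟩
  change D.evalFrom 1 w ∈ P ↔ φ (FreeMonoid.ofList w) ∈ P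
  rw [hD, one_mul]

theorem IsRegularSet.finite_synt {L : Set (FreeMonoid A)} (h : IsRegularSet L) :
    Finite (Synt L) := by
  obtain ⟨σ, _, D, hD⟩ := h
  have hmem : ∀ w : FreeMonoid A, w ∈ L ↔ D.evalFrom D.start w.toList ∈ D.accept := fun w => by
    change w.toList ∈ (FreeMonoid.ofList ⁻¹' L : Set (List A)) ↔ _
    rw [← hD]
    rfl
  let r := Function.surjInv (syntacticHom_surjective L)
  refine Finite.of_injective (β := σ → σ) (fun q s => D.evalFrom s (r q).toList) fun p q hpq => ?_
  rw [← Function.surjInv_eq (syntacticHom_surjective L) p,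
    ← Function.surjInv_eq (syntacticHom_surjective L) q]
  refine (Con.eq _).mpr fun s t => ?_
  have := congrFun hpq (D.evalFrom D.start s.toList)
  simp only [hmem, FreeMonoid.toList_mul, DFA.evalFrom_of_append]
  simp only [r] at this
  rw [this]

/-- The lower sets of the syntactic order are determined by quotients of the language. -/
theorem syntacticHom_le_iff (L : Set (FreeMonoid A)) (w : FreeMonoid A) (m : Synt L) :
    syntacticHom L w ≤ m ↔ ∀ s t : FreeMonoid A,
      syntacticHom L s * m * syntacticHom L t ∈ syntacticHom L '' L → s * w * t ∈ L := by
  constructor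
  · intro h s t hst
    rw [← syntacticHom_mem_image, map_mul, map_mul]
    exact h _ _ hst
  · intro h s t hst
    obtain ⟨s, rfl⟩ := syntacticHom_surjective L s
    obtain ⟨t, rfl⟩ := syntacticHom_surjective L t
    rw [← map_mul, ← map_mul, syntacticHom_mem_image]
    exact h s t hst

theorem le_syntacticHom_iff (L : Set (FreeMonoid A)) (w : FreeMonoid A) (m : Synt L) :
    m ≤ syntacticHom L w ↔ ∀ s t : FreeMonoid A,
      syntacticHom L s * m * syntacticHom L t ∉ syntacticHom L '' L → s * w * t ∉ L := by
  constructor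
  · intro h s t hst hw
    rw [← syntacticHom_mem_image, map_mul, map_mul] at hw
    exact hst (h _ _ hw)
  · intro h s t hst
    obtain ⟨s, rfl⟩ := syntacticHom_surjective L s
    obtain ⟨t, rfl⟩ := syntacticHom_surjective L t
    rw [← map_mul, ← map_mul, syntacticHom_mem_image] at hst
    by_contra hn
    exact h s t hn hst

end Recognition

/-! ### Closure properties of varieties of languages -/

namespace IsPositiveCVariety

variable {C : MorphismClass.{u}} {𝒱 : LanguageClass.{u}}

theorem iUnion_mem (h : IsPositiveCVariety C 𝒱) {A : Type u} [Finite A] {ι : Type*} [Finite ι]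
    {L : ι → Set (FreeMonoid A)} (hL : ∀ i, L i ∈ 𝒱.langs A) : ⋃ i, L i ∈ 𝒱.langs A := by
  have := Fintype.ofFinite ι
  change ⨆ i, L i ∈ _
  rw [← Finset.sup_univ_eq_iSup]
  exact Finset.sup_mem _ (h.empty_mem A) (h.union_mem A) _ _ fun i _ => hL i

theorem iInter_mem (h : IsPositiveCVariety C 𝒱) {A : Type u} [Finite A] {ι : Type*} [Finite ι]
    {L : ι → Set (FreeMonoid A)} (hL : ∀ i, L i ∈ 𝒱.langs A) : ⋂ i, L i ∈ 𝒱.langs A := by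
  have := Fintype.ofFinite ι
  change ⨅ i, L i ∈ _
  rw [← Finset.inf_univ_eq_iInf]
  exact Finset.inf_mem _ (h.univ_mem A) (h.inter_mem A) _ _ fun i _ => hL i

theorem quotient_mem (h : IsPositiveCVariety C 𝒱) {A : Type u} [Finite A]
    {L : Set (FreeMonoid A)} (hL : L ∈ 𝒱.langs A) (s t : FreeMonoid A) :
    {w | s * w * t ∈ L} ∈ 𝒱.langs A :=
  h.left_quotient_mem A _ (h.right_quotient_mem A L hL t) s

theorem setOf_forall_mem (h : IsPositiveCVariety C 𝒱) {A : Type u} [Finite A]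
    {L : Set (FreeMonoid A)} [Finite (Synt L)] {K : FreeMonoid A → FreeMonoid A → Set (FreeMonoid A)}
    (hK : ∀ s t, K s t ∈ 𝒱.langs A)
    (hKL : ∀ s s' t t', syntacticHom L s = syntacticHom L s' → syntacticHom L t = syntacticHom L t' →
      K s t = K s' t')
    (Q : Synt L → Synt L → Prop) :
    {w | ∀ s t, Q (syntacticHom L s) (syntacticHom L t) → w ∈ K s t} ∈ 𝒱.langs A := by
  let r := Function.surjInv (syntacticHom_surjective L)
  have hr : ∀ q, syntacticHom L (r q) = q := Function.surjInv_eq _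
  have : {w | ∀ s t, Q (syntacticHom L s) (syntacticHom L t) → w ∈ K s t} =
      ⋂ p : {p : Synt L × Synt L // Q p.1 p.2}, K (r p.1.1) (r p.1.2) := by
    ext w
    simp only [Set.mem_ofPred_eq, Set.mem_iInter, Subtype.forall, Prod.forall]
    refine ⟨fun hw p q hpq => hw _ _ (by rwa [hr, hr]), fun hw s t hst => ?_⟩
    rw [hKL s _ t _ (hr _).symm (hr _).symm]
    exact hw _ _ hst
  rw [this]
  exact h.iInter_mem fun _ => hK _ _

theorem mul_mem_congr {A : Type u} {L : Set (FreeMonoid A)} {s s' t t' : FreeMonoid A}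
    (hs : syntacticHom L s = syntacticHom L s') (ht : syntacticHom L t = syntacticHom L t')
    (w : FreeMonoid A) : s * w * t ∈ L ↔ s' * w * t' ∈ L := by
  simp only [← syntacticHom_mem_image L, map_mul, hs, ht]

theorem setOf_syntacticHom_le_mem (h : IsPositiveCVariety C 𝒱) {A : Type u} [Finite A]
    {L : Set (FreeMonoid A)} (hL : L ∈ 𝒱.langs A) (m : Synt L) :
    {w | syntacticHom L w ≤ m} ∈ 𝒱.langs A := by
  have := (𝒱.regular A L hL).finite_synt
  simp only [syntacticHom_le_iff]
  exact h.setOf_forall_mem (L := L) (K := fun s t => {w | s * w * t ∈ L}) (h.quotient_mem hL)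
    (fun s s' t t' hs ht => Set.ext fun w => mul_mem_congr hs ht w)
    fun p q : Synt L => p * m * q ∈ syntacticHom L '' L

theorem preimage_lowerSet_mem (h : IsPositiveCVariety C 𝒱) {A : Type u} [Finite A]
    {L : Set (FreeMonoid A)} (hL : L ∈ 𝒱.langs A) {P : Set (Synt L)} (hP : IsLowerSet P) :
    syntacticHom L ⁻¹' P ∈ 𝒱.langs A := by
  have := (𝒱.regular A L hL).finite_synt
  have : syntacticHom L ⁻¹' P = ⋃ m : P, {w | syntacticHom L w ≤ m} := by
    ext w
    simp only [Set.mem_preimage, Set.mem_iUnion, Set.mem_ofPred_eq, Subtype.exists, exists_prop]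
    exact ⟨fun hw => ⟨_, hw, le_rfl⟩, fun ⟨m, hm, hw⟩ => hP hw hm⟩
  rw [this]
  exact h.iUnion_mem fun m => h.setOf_syntacticHom_le_mem hL m

end IsPositiveCVariety

theorem IsCVariety.preimage_syntacticHom_mem {C : MorphismClass.{u}} {𝒱 : LanguageClass.{u}}
    (h : IsCVariety C 𝒱) {A : Type u} [Finite A] {L : Set (FreeMonoid A)} (hL : L ∈ 𝒱.langs A)
    (P : Set (Synt L)) : syntacticHom L ⁻¹' P ∈ 𝒱.langs A := by
  have := (𝒱.regular A L hL).finite_synt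
  have hge : ∀ m, {w | m ≤ syntacticHom L w} ∈ 𝒱.langs A := fun m => by
    simp only [le_syntacticHom_iff]
    exact h.setOf_forall_mem (L := L) (K := fun s t => {w | s * w * t ∈ L}ᶜ)
      (fun s t => h.compl_mem A _ (h.quotient_mem hL s t))
      (fun s s' t t' hs ht => Set.ext fun w => not_congr
        (IsPositiveCVariety.mul_mem_congr hs ht w))
      fun p q : Synt L => p * m * q ∉ syntacticHom L '' L
  have : syntacticHom L ⁻¹' P =
      ⋃ m : P, {w | syntacticHom L w ≤ m} ∩ {w | m ≤ syntacticHom L w} := by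
    ext w
    simp only [Set.mem_preimage, Set.mem_iUnion, Set.mem_inter_iff, Set.mem_ofPred_eq,
      Subtype.exists, exists_prop]
    refine ⟨fun hw => ⟨_, hw, le_rfl, le_rfl⟩, fun ⟨m, hm, h₁, h₂⟩ => ?_⟩
    rwa [le_antisymm h₁ h₂]
  rw [this]
  exact h.iUnion_mem fun m => h.inter_mem A _ (h.setOf_syntacticHom_le_mem hL m) _ (hge m)

/-! ### Pseudovarieties of stamps -/

theorem MorphismClass.IsAdmissible.id_mem {C : MorphismClass.{u}} (hC : C.IsAdmissible)
    (A : Type u) [Finite A] : MonoidHom.id (FreeMonoid A) ∈ C A A :=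
  hC.length_preserving_mem _ fun _ => rfl

theorem allMorphisms_isAdmissible : allMorphisms.{u}.IsAdmissible :=
  ⟨fun _ _ _ _ => trivial, fun _ _ => trivial⟩

namespace IsCPseudovariety

variable {C : MorphismClass.{u}} {V W : StampClass.{u}}

theorem mem_of_ker_comp_le (hV : IsCPseudovariety C V) {A B : Type u} [Finite A] [Finite B]
    {φ : Stamp A} (hφ : φ ∈ V A) {ψ : FreeMonoid B →* FreeMonoid A} (hψ : ψ ∈ C B A)
    {θ : Stamp B} (h : ∀ v w, φ.hom (ψ v) = φ.hom (ψ w) → θ.hom v = θ.hom w) : θ ∈ V B := by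
  obtain ⟨η, hη⟩ := exists_comp_eq_of_surjective (φ.hom.comp ψ).mrangeRestrict
    (MonoidHom.mrangeRestrict_surjective _) θ.hom fun v w hvw => h v w (congrArg Subtype.val hvw)
  have hs : Function.Surjective η := fun m => by
    obtain ⟨w, rfl⟩ := θ.surjective m
    exact ⟨_, DFunLike.congr_fun hη w⟩
  have key : ∀ f hf, f = θ.hom → (⟨θ.carrier, f, hf⟩ : Stamp B) = θ := by
    rintro _ _ rfl
    rfl
  rw [← key _ _ hη]
  exact hV.pull_mem A B φ hφ ψ hψ ⟨θ.carrier⟩ η hs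

theorem mem_of_ker_le (hV : IsCPseudovariety C V) (hC : C.IsAdmissible) {A : Type u} [Finite A]
    {φ θ : Stamp A} (hφ : φ ∈ V A) (h : ∀ v w, φ.hom v = φ.hom w → θ.hom v = θ.hom w) :
    θ ∈ V A :=
  hV.mem_of_ker_comp_le hφ (hC.id_mem A) h

theorem exists_common_refinement (hV : IsCPseudovariety C V) {A : Type u} [Finite A]
    {ι : Type*} [Finite ι] {θ : ι → Stamp A} (hθ : ∀ i, θ i ∈ V A) :
    ∃ φ ∈ V A, ∀ i v w, φ.hom v = φ.hom w → (θ i).hom v = (θ i).hom w := by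
  classical
  have := Fintype.ofFinite ι
  suffices ∀ s : Finset ι, ∃ φ ∈ V A, ∀ i ∈ s, ∀ v w, φ.hom v = φ.hom w →
      (θ i).hom v = (θ i).hom w by
    obtain ⟨φ, hφ, h⟩ := this Finset.univ
    exact ⟨φ, hφ, fun i => h i (Finset.mem_univ i)⟩
  intro s
  induction s using Finset.induction_on with
  | empty => exact ⟨_, hV.trivial_mem A, by simp⟩
  | insert i s _ ih =>
    obtain ⟨φ, hφ, h⟩ := ih
    refine ⟨_, hV.prod_mem A _ (hθ i) _ hφ, fun j hj v w hvw => ?_⟩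
    have hvw' := Prod.ext_iff.mp (congrArg Subtype.val hvw)
    rcases Finset.mem_insert.mp hj with rfl | hj
    · exact hvw'.1
    · exact h j hj v w hvw'.2

theorem mem_languagesOfStamps_iff (hV : IsCPseudovariety C V) (hC : C.IsAdmissible)
    {A : Type u} [Finite A] {L : Set (FreeMonoid A)} :
    L ∈ (languagesOfStamps V).langs A ↔ ∃ φ ∈ V A, ∃ P, L = φ.hom ⁻¹' P := by
  constructor
  · rintro ⟨-, _, h⟩
    exact ⟨_, h, _, (preimage_image_syntacticHom L).symm⟩
  · rintro ⟨φ, hφ, P, rfl⟩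
    have hr := isRegularSet_preimage φ.hom P
    exact ⟨hr, hr.finite_synt, hV.mem_of_ker_le hC hφ fun v w => syntacticHom_preimage_eq _ _⟩

theorem isCVariety_languagesOfStamps (hV : IsCPseudovariety C V) (hC : C.IsAdmissible) :
    IsCVariety C (languagesOfStamps V) where
  empty_mem A _ := (hV.mem_languagesOfStamps_iff hC).mpr ⟨_, hV.trivial_mem A, ∅, rfl⟩
  univ_mem A _ := (hV.mem_languagesOfStamps_iff hC).mpr ⟨_, hV.trivial_mem A, Set.univ, rfl⟩
  union_mem A _ K hK L hL := by
    rw [hV.mem_languagesOfStamps_iff hC] at *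
    obtain ⟨φ, hφ, P, rfl⟩ := hK
    obtain ⟨ψ, hψ, Q, rfl⟩ := hL
    exact ⟨_, hV.prod_mem A φ hφ ψ hψ, {p | p.1.1 ∈ P ∨ p.1.2 ∈ Q}, rfl⟩
  inter_mem A _ K hK L hL := by
    rw [hV.mem_languagesOfStamps_iff hC] at *
    obtain ⟨φ, hφ, P, rfl⟩ := hK
    obtain ⟨ψ, hψ, Q, rfl⟩ := hL
    exact ⟨_, hV.prod_mem A φ hφ ψ hψ, {p | p.1.1 ∈ P ∧ p.1.2 ∈ Q}, rfl⟩
  compl_mem A _ L hL := by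
    rw [hV.mem_languagesOfStamps_iff hC] at *
    obtain ⟨φ, hφ, P, rfl⟩ := hL
    exact ⟨φ, hφ, Pᶜ, rfl⟩
  left_quotient_mem A _ L hL v := by
    rw [hV.mem_languagesOfStamps_iff hC] at *
    obtain ⟨φ, hφ, P, rfl⟩ := hL
    exact ⟨φ, hφ, {m | φ.hom v * m ∈ P}, Set.ext fun w => by simp⟩
  right_quotient_mem A _ L hL v := by
    rw [hV.mem_languagesOfStamps_iff hC] at *
    obtain ⟨φ, hφ, P, rfl⟩ := hL
    exact ⟨φ, hφ, {m | m * φ.hom v ∈ P}, Set.ext fun w => by simp⟩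
  preimage_mem A B _ _ ψ hψ L hL := by
    rw [hV.mem_languagesOfStamps_iff hC] at *
    obtain ⟨φ, hφ, P, rfl⟩ := hL
    exact ⟨_, hV.pull_mem B A φ hφ ψ hψ ⟨MonoidHom.mrange (φ.hom.comp ψ)⟩ (MonoidHom.id _)
      Function.surjective_id, {m | m.1 ∈ P}, rfl⟩

theorem subset_of_languagesOfStamps_eq (hW : IsCPseudovariety C W) (hV : IsCPseudovariety C V)
    (hC : C.IsAdmissible) (h : languagesOfStamps V = languagesOfStamps W) {A : Type u} [Finite A]
    {φ : Stamp A} (hφ : φ ∈ V A) : φ ∈ W A := by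
  have key : ∀ m : φ.carrier, ∃ θ ∈ W A, ∃ P, φ.hom ⁻¹' {m} = θ.hom ⁻¹' P := fun m => by
    rw [← hW.mem_languagesOfStamps_iff hC, ← h, hV.mem_languagesOfStamps_iff hC]
    exact ⟨φ, hφ, {m}, rfl⟩
  choose θ hθ P hP using key
  obtain ⟨χ, hχ, hker⟩ := hW.exists_common_refinement hθ
  refine hW.mem_of_ker_le hC hχ fun v w hvw => ?_
  have hv : v ∈ φ.hom ⁻¹' {φ.hom v} := rfl
  rw [hP, Set.mem_preimage, hker _ v w hvw, ← Set.mem_preimage, ← hP] at hv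
  exact hv.symm

end IsCPseudovariety

/-- The stamps all of whose recognised languages are in `𝒱`. -/
def stampsOf (𝒱 : LanguageClass.{u}) : StampClass.{u} := fun A _ =>
  {φ | ∀ P, φ.hom ⁻¹' P ∈ 𝒱.langs A}

namespace IsCVariety

variable {C : MorphismClass.{u}} {𝒱 : LanguageClass.{u}}

theorem isCPseudovariety_stampsOf (h : IsCVariety C 𝒱) : IsCPseudovariety C (stampsOf 𝒱) where
  trivial_mem A _ P := by
    by_cases hP : PUnit.unit ∈ P
    · convert h.univ_mem A
      exact Set.eq_univ_of_forall fun _ => hP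
    · convert h.empty_mem A
      exact Set.eq_empty_of_forall_notMem fun _ => hP
  prod_mem A _ φ hφ ψ hψ P := by
    have : (φ.prod ψ).hom ⁻¹' P = ⋃ p : P, φ.hom ⁻¹' {p.1.1.1} ∩ ψ.hom ⁻¹' {p.1.1.2} := by
      ext w
      simp only [Set.mem_preimage, Set.mem_iUnion, Set.mem_inter_iff, Set.mem_singleton_iff]
      refine ⟨fun hw => ⟨⟨_, hw⟩, rfl, rfl⟩, fun ⟨p, h₁, h₂⟩ => ?_⟩
      convert p.2
      exact Subtype.ext (Prod.ext h₁ h₂)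
    rw [this]
    exact h.iUnion_mem fun p => h.inter_mem A _ (hφ _) _ (hψ _)
  pull_mem A B _ _ φ hφ ψ hψ N η hη P := by
    convert h.preimage_mem B A ψ hψ _ (hφ {m | ∃ hm, η ⟨m, hm⟩ ∈ P}) using 1
    ext w
    exact ⟨fun hw => ⟨⟨w, rfl⟩, hw⟩, fun ⟨_, hw⟩ => hw⟩

theorem languagesOfStamps_stampsOf (h : IsCVariety C 𝒱) :
    languagesOfStamps (stampsOf 𝒱) = 𝒱 := by
  ext A _ L
  constructor
  · rintro ⟨-, _, hL⟩
    have := hL (syntacticHom L '' L)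
    rwa [preimage_image_syntacticHom] at this
  · intro hL
    have hr := 𝒱.regular A L hL
    exact ⟨hr, hr.finite_synt, h.preimage_syntacticHom_mem hL⟩

end IsCVariety

theorem bijOn_languagesOfStamps {C : MorphismClass.{u}} (hC : C.IsAdmissible) :
    Set.BijOn languagesOfStamps {V | IsCPseudovariety C V} {𝒱 | IsCVariety C 𝒱} := by
  refine ⟨fun V hV => hV.isCVariety_languagesOfStamps hC, fun V hV W hW h => ?_, fun 𝒱 h =>
    ⟨_, h.isCPseudovariety_stampsOf, h.languagesOfStamps_stampsOf⟩⟩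
  funext A _
  exact Set.Subset.antisymm (fun φ => hW.subset_of_languagesOfStamps_eq hV hC h)
    (fun φ => hV.subset_of_languagesOfStamps_eq hW hC h.symm)

/-! ### Reiterman's theorem for stamps -/

theorem Stamp.cSatisfies_iff {C : MorphismClass.{u}} {A : Type u} [Finite A] {φ : Stamp A}
    {e : ProfiniteIdentity.{u}} : φ.CSatisfies C e ↔
      ∀ ψ ∈ C e.X A, hat (φ.hom.comp ψ) e.lhs = hat (φ.hom.comp ψ) e.rhs := by
  simp only [Stamp.CSatisfies, hat_hatMap]

theorem isCPseudovariety_cDefinedBy {C : MorphismClass.{u}} (hC : C.IsAdmissible)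
    (E : Set ProfiniteIdentity.{u}) : IsCPseudovariety C (cDefinedBy C E) where
  trivial_mem A _ e _ ψ _ := Subsingleton.elim (α := PUnit) _ _
  prod_mem A _ φ₁ h₁ φ₂ h₂ e he := by
    rw [Stamp.cSatisfies_iff]
    intro ψ hψ
    have h₁' := Stamp.cSatisfies_iff.mp (h₁ e he) ψ hψ
    have h₂' := Stamp.cSatisfies_iff.mp (h₂ e he) ψ hψ
    let p := MonoidHom.mrange (φ₁.hom.prod φ₂.hom)
    refine Subtype.ext (Prod.ext ?_ ?_)
    · have := fun x => hat_comp ((MonoidHom.fst _ _).comp p.subtype) ((φ₁.prod φ₂).hom.comp ψ) x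
      exact (this _).symm.trans (h₁'.trans (this _))
    · have := fun x => hat_comp ((MonoidHom.snd _ _).comp p.subtype) ((φ₁.prod φ₂).hom.comp ψ) x
      exact (this _).symm.trans (h₂'.trans (this _))
  pull_mem A B _ _ φ hφ ψ hψ N η hη e he := by
    rw [Stamp.cSatisfies_iff]
    intro χ hχ
    refine hat_eq_of_ker_le (fun v w hvw => ?_)
      (Stamp.cSatisfies_iff.mp (hφ e he) _ (hC.comp_mem ψ χ hψ hχ))
    exact congrArg η (Subtype.ext hvw)

theorem IsCPseudovariety.exists_eq_cDefinedBy {C : MorphismClass.{u}} (hC : C.IsAdmissible)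
    {V : StampClass.{u}} (hV : IsCPseudovariety C V) : ∃ E, V = cDefinedBy C E := by
  refine ⟨{e | ∀ (A : Type u) [Finite A], ∀ φ ∈ V A, φ.CSatisfies C e}, ?_⟩
  funext A _
  refine Set.Subset.antisymm (fun φ hφ e he => he A φ hφ) fun φ hφ => ?_
  by_contra hn
  have : Nonempty {θ // θ ∈ V A} := ⟨⟨_, hV.trivial_mem A⟩⟩
  obtain ⟨⟨x, y⟩, hxy⟩ := exists_common_pair
    (fun (θ : {θ // θ ∈ V A}) p => hat θ.1.hom p.1 = hat θ.1.hom p.2 ∧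
      hat φ.hom p.1 ≠ hat φ.hom p.2)
    (fun θ => by
      have h₁ := isLocallyConstant_hat θ.1.hom
      have h₂ := isLocallyConstant_hat φ.hom
      exact ((h₁.comp_continuous continuous_fst).comp₂ (h₁.comp_continuous continuous_snd)
        (· = ·)).comp₂ ((h₂.comp_continuous continuous_fst).comp₂
          (h₂.comp_continuous continuous_snd) (· ≠ ·)) (· ∧ ·))
    (fun θ => by
      by_contra! hne
      refine hn (hV.mem_of_ker_le hC θ.2 fun v w hvw => ?_)
      have := hne ((v : FreeProfinite A), (w : FreeProfinite A))
      simp only [hat_coe] at this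
      exact this hvw)
    (fun θ θ' => ⟨⟨_, hV.prod_mem A _ θ.2 _ θ'.2⟩, fun p hp =>
      ⟨⟨hat_eq_of_ker_le (fun v w hvw => (Prod.ext_iff.mp (congrArg Subtype.val hvw)).1) hp.1,
        hp.2⟩,
       ⟨hat_eq_of_ker_le (fun v w hvw => (Prod.ext_iff.mp (congrArg Subtype.val hvw)).2) hp.1,
        hp.2⟩⟩⟩)
  refine (hxy this.some).2 ?_
  have he := hφ ⟨A, x, y⟩ fun B _ θ hθ => Stamp.cSatisfies_iff.mpr fun ψ hψ => by
    have hp := hV.pull_mem B A θ hθ ψ hψ ⟨MonoidHom.mrange (θ.hom.comp ψ)⟩ (MonoidHom.id _)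
      Function.surjective_id
    exact hat_eq_of_ker_le (fun v w hvw => congrArg Subtype.val hvw) (hxy ⟨_, hp⟩).1
  exact Stamp.cSatisfies_iff.mp he (MonoidHom.id _) (hC.id_mem A)

theorem isCPseudovariety_iff {C : MorphismClass.{u}} (hC : C.IsAdmissible)
    (V : StampClass.{u}) : IsCPseudovariety C V ↔ ∃ E, V = cDefinedBy C E :=
  ⟨fun hV => hV.exists_eq_cDefinedBy hC,
    fun ⟨E, hE⟩ => hE ▸ isCPseudovariety_cDefinedBy hC E⟩

/-! ### Pseudovarieties of monoids -/

/-- The stamps onto a monoid in `V`. -/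
def stampsOnto (V : Set FinMonoid.{u}) : StampClass.{u} := fun _ _ =>
  {φ | (⟨φ.carrier⟩ : FinMonoid) ∈ V}

/-- The evaluation morphism `M* → M`, as a stamp. -/
def evalStamp (M : FinMonoid.{u}) : Stamp M.carrier :=
  ⟨M.carrier, evalHom M.carrier, evalHom_surjective M.carrier⟩

/-- The monoids `M` such that the evaluation morphism `M* → M` is in `W`. -/
def carriersOf (W : StampClass.{u}) : Set FinMonoid.{u} := {M | evalStamp M ∈ W M.carrier}

theorem carriersOf_stampsOnto (V : Set FinMonoid.{u}) : carriersOf (stampsOnto V) = V := rfl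

theorem languagesOfStamps_stampsOnto (V : Set FinMonoid.{u}) :
    languagesOfStamps (stampsOnto V) = languagesOf V := rfl

theorem IsPseudovariety.isCPseudovariety_stampsOnto {V : Set FinMonoid.{u}}
    (hV : IsPseudovariety V) (C : MorphismClass.{u}) : IsCPseudovariety C (stampsOnto V) where
  trivial_mem _ _ := hV.trivial_mem
  prod_mem _ _ φ₁ h₁ φ₂ h₂ := hV.divides_mem _ _ (hV.prod_mem _ h₁ _ h₂)
    ⟨MonoidHom.mrange (φ₁.hom.prod φ₂.hom), MonoidHom.id _, Function.surjective_id⟩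
  pull_mem _ _ _ _ _ hφ _ _ _ η hη := hV.divides_mem _ _ hφ ⟨_, η, hη⟩

namespace IsCPseudovariety

variable {W : StampClass.{u}}

theorem mem_of_divides (hW : IsCPseudovariety allMorphisms W) {A B : Type u} [Finite A] [Finite B]
    {φ : Stamp A} (hφ : φ ∈ W A) {θ : Stamp B}
    (h : FinMonoid.Divides ⟨θ.carrier⟩ ⟨φ.carrier⟩) : θ ∈ W B := by
  obtain ⟨S, f, hf⟩ := h
  obtain ⟨χ, hχ⟩ := exists_lift_of_surjective f hf θ.hom
  obtain ⟨ψ, hψ⟩ := exists_lift_of_surjective φ.hom φ.surjective (S.subtype.comp χ)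
  refine hW.mem_of_ker_comp_le hφ (ψ := ψ) trivial fun v w hvw => ?_
  rw [← MonoidHom.comp_apply, ← MonoidHom.comp_apply, hψ] at hvw
  rw [← hχ, MonoidHom.comp_apply, MonoidHom.comp_apply,
    show χ v = χ w from Subtype.ext hvw]

theorem isPseudovariety_carriersOf (hW : IsCPseudovariety allMorphisms W) :
    IsPseudovariety (carriersOf W) where
  trivial_mem := hW.mem_of_divides (hW.trivial_mem PUnit) ⟨⊤, 1, fun _ => ⟨1, rfl⟩⟩
  prod_mem M hM N hN := by
    let e := evalHom (M.carrier × N.carrier)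
    have he := evalHom_surjective (M.carrier × N.carrier)
    have h₁ : (⟨M.carrier, (MonoidHom.fst _ _).comp e, Prod.fst_surjective.comp he⟩ : Stamp _) ∈
        W (M.carrier × N.carrier) :=
      hW.mem_of_divides hM ⟨⊤, Submonoid.subtype _, fun m => ⟨⟨m, trivial⟩, rfl⟩⟩
    have h₂ : (⟨N.carrier, (MonoidHom.snd _ _).comp e, Prod.snd_surjective.comp he⟩ : Stamp _) ∈
        W (M.carrier × N.carrier) :=
      hW.mem_of_divides hN ⟨⊤, Submonoid.subtype _, fun m => ⟨⟨m, trivial⟩, rfl⟩⟩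
    exact hW.mem_of_ker_le allMorphisms_isAdmissible (hW.prod_mem _ _ h₁ _ h₂)
      fun v w hvw => congrArg Subtype.val hvw
  divides_mem _ _ hN h := hW.mem_of_divides hN h

theorem stampsOnto_carriersOf (hW : IsCPseudovariety allMorphisms W) :
    stampsOnto (carriersOf W) = W := by
  funext A _
  ext φ
  exact ⟨fun h => hW.mem_of_divides h ⟨⊤, Submonoid.subtype _, fun m => ⟨⟨m, trivial⟩, rfl⟩⟩,
    fun h => hW.mem_of_divides h ⟨⊤, Submonoid.subtype _, fun m => ⟨⟨m, trivial⟩, rfl⟩⟩⟩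

end IsCPseudovariety

theorem bijOn_languagesOf :
    Set.BijOn languagesOf {V : Set FinMonoid.{u} | IsPseudovariety V} {𝒱 | IsVariety 𝒱} := by
  have hb := bijOn_languagesOfStamps allMorphisms_isAdmissible.{u}
  refine ⟨fun V hV => hb.mapsTo (hV.isCPseudovariety_stampsOnto _), fun V hV W hW h => ?_,
    fun 𝒱 h => ?_⟩
  · have := hb.injOn (hV.isCPseudovariety_stampsOnto _) (hW.isCPseudovariety_stampsOnto _) h
    rw [← carriersOf_stampsOnto V, this, carriersOf_stampsOnto]
  · obtain ⟨W, hW, rfl⟩ := hb.surjOn h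
    refine ⟨_, hW.isPseudovariety_carriersOf, ?_⟩
    rw [← languagesOfStamps_stampsOnto, hW.stampsOnto_carriersOf]

theorem Stamp.cSatisfies_allMorphisms_iff {A : Type u} [Finite A] {φ : Stamp A}
    {e : ProfiniteIdentity.{u}} :
    φ.CSatisfies allMorphisms e ↔ (⟨φ.carrier⟩ : FinMonoid).Satisfies e := by
  rw [Stamp.cSatisfies_iff]
  refine ⟨fun h χ => ?_, fun h ψ _ => h _⟩
  obtain ⟨ψ, rfl⟩ := exists_lift_of_surjective φ.hom φ.surjective χ
  exact h ψ (Set.mem_univ ψ)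

theorem stampsOnto_definedBy (E : Set ProfiniteIdentity.{u}) :
    stampsOnto (definedBy E) = cDefinedBy allMorphisms E := by
  funext A _
  ext φ
  exact forall₂_congr fun e _ => Stamp.cSatisfies_allMorphisms_iff.symm

theorem isPseudovariety_iff (V : Set FinMonoid.{u}) :
    IsPseudovariety V ↔ ∃ E, V = definedBy E := by
  constructor
  · intro hV
    obtain ⟨E, hE⟩ := (hV.isCPseudovariety_stampsOnto _).exists_eq_cDefinedBy
      allMorphisms_isAdmissible
    refine ⟨E, ?_⟩
    rw [← carriersOf_stampsOnto V, hE, ← stampsOnto_definedBy, carriersOf_stampsOnto]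
  · rintro ⟨E, rfl⟩
    rw [← carriersOf_stampsOnto (definedBy E), stampsOnto_definedBy]
    exact (isCPseudovariety_cDefinedBy allMorphisms_isAdmissible E).isPseudovariety_carriersOf

/-! ### Pseudovarieties of ordered monoids -/

theorem hat_le_hat_of_le {A M N : Type u} [Finite A] [Monoid M] [Finite M] [Monoid N] [Finite N]
    [LE M] [LE N] {φ : FreeMonoid A →* M} {ψ : FreeMonoid A →* N}
    (h : ∀ v w, φ v ≤ φ w → ψ v ≤ ψ w) {x y : FreeProfinite A} (hxy : hat φ x ≤ hat φ y) :
    hat ψ x ≤ hat ψ y := by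
  obtain ⟨v, hv, hv'⟩ := exists_word_hat_eq φ ψ x
  obtain ⟨w, hw, hw'⟩ := exists_word_hat_eq φ ψ y
  rw [hv', hw']
  exact h _ _ (by rwa [← hv, ← hw])

theorem isLowerSet_image_syntacticHom {A : Type u} (L : Set (FreeMonoid A)) :
    IsLowerSet (syntacticHom L '' L) := fun a b hba ha => by
  simpa using hba 1 1 (by simpa using ha)

theorem FinOrdMonoid.divides_of_le {A : Type u} {M N : FinOrdMonoid.{u}}
    (φ : FreeMonoid A →* N.carrier) (θ : FreeMonoid A →* M.carrier)
    (hθ : Function.Surjective θ) (h : ∀ v w, φ v ≤ φ w → θ v ≤ θ w) : M.Divides N := by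
  obtain ⟨f, hf⟩ := exists_comp_eq_of_surjective φ.mrangeRestrict
    (MonoidHom.mrangeRestrict_surjective _) θ fun v w hvw =>
      have e : φ v = φ w := congrArg Subtype.val hvw
      le_antisymm (h v w e.le) (h w v e.ge)
  refine ⟨MonoidHom.mrange φ, f, fun m => ?_, ?_⟩
  · obtain ⟨w, rfl⟩ := hθ m
    exact ⟨_, DFunLike.congr_fun hf w⟩
  · intro a b hab
    obtain ⟨v, rfl⟩ := φ.mrangeRestrict_surjective a
    obtain ⟨w, rfl⟩ := φ.mrangeRestrict_surjective b
    rw [← MonoidHom.comp_apply, ← MonoidHom.comp_apply, hf]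
    exact h v w hab

namespace IsOrdPseudovariety

variable {V W : Set FinOrdMonoid.{u}}

theorem mem_languagesOfOrd_iff (hV : IsOrdPseudovariety V) {A : Type u} [Finite A]
    {L : Set (FreeMonoid A)} : L ∈ (languagesOfOrd V).langs A ↔
      ∃ N ∈ V, ∃ (φ : FreeMonoid A →* N.carrier) (P : Set N.carrier),
        IsLowerSet P ∧ L = φ ⁻¹' P := by
  constructor
  · rintro ⟨-, _, h⟩
    exact ⟨_, h, syntacticHom L, _, isLowerSet_image_syntacticHom L,
      (preimage_image_syntacticHom L).symm⟩
  · rintro ⟨N, hN, φ, P, hP, rfl⟩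
    have hr := isRegularSet_preimage φ P
    have hf := hr.finite_synt
    refine ⟨hr, hf, hV.divides_mem _ _ hN (FinOrdMonoid.divides_of_le φ (syntacticHom (φ ⁻¹' P))
      (syntacticHom_surjective _) fun v w hvw => ?_)⟩
    rw [syntacticHom_le_iff]
    intro s t hst
    rw [← map_mul, ← map_mul, syntacticHom_mem_image] at hst
    refine hP ?_ hst
    rw [map_mul, map_mul, map_mul, map_mul]
    exact N.mul_le_mul _ _ _ _ (N.mul_le_mul _ _ _ _ le_rfl hvw) le_rfl

theorem isPositiveVariety_languagesOfOrd (hV : IsOrdPseudovariety V) :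
    IsPositiveVariety (languagesOfOrd V) where
  empty_mem _ _ := hV.mem_languagesOfOrd_iff.mpr
    ⟨_, hV.trivial_mem, 1, ∅, isLowerSet_empty, rfl⟩
  univ_mem _ _ := hV.mem_languagesOfOrd_iff.mpr
    ⟨_, hV.trivial_mem, 1, Set.univ, isLowerSet_univ, rfl⟩
  union_mem A _ K hK L hL := by
    rw [hV.mem_languagesOfOrd_iff] at *
    obtain ⟨M, hM, φ, P, hP, rfl⟩ := hK
    obtain ⟨N, hN, ψ, Q, hQ, rfl⟩ := hL
    exact ⟨_, hV.prod_mem M hM N hN, φ.prod ψ, {p | p.1 ∈ P ∨ p.2 ∈ Q},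
      fun _ _ hba => Or.imp (hP hba.1) (hQ hba.2), rfl⟩
  inter_mem A _ K hK L hL := by
    rw [hV.mem_languagesOfOrd_iff] at *
    obtain ⟨M, hM, φ, P, hP, rfl⟩ := hK
    obtain ⟨N, hN, ψ, Q, hQ, rfl⟩ := hL
    exact ⟨_, hV.prod_mem M hM N hN, φ.prod ψ, {p | p.1 ∈ P ∧ p.2 ∈ Q},
      fun _ _ hba => And.imp (fun h => hP hba.1 h) (fun h => hQ hba.2 h), rfl⟩
  left_quotient_mem A _ L hL v := by
    rw [hV.mem_languagesOfOrd_iff] at *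
    obtain ⟨N, hN, φ, P, hP, rfl⟩ := hL
    exact ⟨N, hN, φ, {m | φ v * m ∈ P}, fun _ _ hba => hP (N.mul_le_mul _ _ _ _ le_rfl hba),
      Set.ext fun w => by simp⟩
  right_quotient_mem A _ L hL v := by
    rw [hV.mem_languagesOfOrd_iff] at *
    obtain ⟨N, hN, φ, P, hP, rfl⟩ := hL
    exact ⟨N, hN, φ, {m | m * φ v ∈ P}, fun _ _ hba => hP (N.mul_le_mul _ _ _ _ hba le_rfl),
      Set.ext fun w => by simp⟩
  preimage_mem A B _ _ ψ _ L hL := by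
    rw [hV.mem_languagesOfOrd_iff] at *
    obtain ⟨N, hN, φ, P, hP, rfl⟩ := hL
    exact ⟨N, hN, φ.comp ψ, P, hP, rfl⟩

theorem exists_common_refinement (hV : IsOrdPseudovariety V) {A : Type u} {ι : Type*} [Finite ι]
    {N : ι → FinOrdMonoid.{u}} (hN : ∀ i, N i ∈ V) (θ : ∀ i, FreeMonoid A →* (N i).carrier) :
    ∃ M ∈ V, ∃ φ : FreeMonoid A →* M.carrier,
      ∀ i v w, φ v ≤ φ w → θ i v ≤ θ i w := by
  classical
  have := Fintype.ofFinite ι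
  suffices ∀ s : Finset ι, ∃ M ∈ V, ∃ φ : FreeMonoid A →* M.carrier,
      ∀ i ∈ s, ∀ v w, φ v ≤ φ w → θ i v ≤ θ i w by
    obtain ⟨M, hM, φ, h⟩ := this Finset.univ
    exact ⟨M, hM, φ, fun i => h i (Finset.mem_univ i)⟩
  intro s
  induction s using Finset.induction_on with
  | empty => exact ⟨_, hV.trivial_mem, 1, by simp⟩
  | insert i s _ ih =>
    obtain ⟨M, hM, φ, h⟩ := ih
    refine ⟨_, hV.prod_mem _ (hN i) M hM, (θ i).prod φ, fun j hj v w hvw => ?_⟩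
    rcases Finset.mem_insert.mp hj with rfl | hj
    · exact hvw.1
    · exact h j hj v w hvw.2

theorem subset_of_languagesOfOrd_eq (hW : IsOrdPseudovariety W) (hV : IsOrdPseudovariety V)
    (h : languagesOfOrd V = languagesOfOrd W) : V ⊆ W := fun M hM => by
  have key : ∀ m : M.carrier, ∃ N ∈ W, ∃ (φ : FreeMonoid M.carrier →* N.carrier)
      (P : Set N.carrier), IsLowerSet P ∧ evalHom M.carrier ⁻¹' Set.Iic m = φ ⁻¹' P := fun m => by
    rw [← hW.mem_languagesOfOrd_iff, ← h, hV.mem_languagesOfOrd_iff]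
    exact ⟨M, hM, _, _, isLowerSet_Iic m, rfl⟩
  choose N hN θ P hP hL using key
  obtain ⟨K, hK, φ, hφ⟩ := hW.exists_common_refinement hN θ
  refine hW.divides_mem _ _ hK (FinOrdMonoid.divides_of_le φ (evalHom M.carrier)
    (evalHom_surjective _) fun v w hvw => ?_)
  have hw : w ∈ evalHom M.carrier ⁻¹' Set.Iic (evalHom M.carrier w) := le_rfl
  rw [hL] at hw
  have hv := hP _ (hφ _ v w hvw) hw
  rw [← Set.mem_preimage, ← hL] at hv
  exact hv

end IsOrdPseudovariety

/-- The ordered monoids whose lower sets recognise only languages in `𝒱`. -/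
def ordMonoidsOf (𝒱 : LanguageClass.{u}) : Set FinOrdMonoid.{u} :=
  {M | ∀ (A : Type u) [Finite A] (φ : FreeMonoid A →* M.carrier) (P : Set M.carrier),
    IsLowerSet P → φ ⁻¹' P ∈ 𝒱.langs A}

namespace IsPositiveVariety

variable {𝒱 : LanguageClass.{u}}

theorem isOrdPseudovariety_ordMonoidsOf (h : IsPositiveVariety 𝒱) :
    IsOrdPseudovariety (ordMonoidsOf 𝒱) where
  trivial_mem A _ φ P _ := by
    by_cases hP : PUnit.unit ∈ P
    · convert IsPositiveCVariety.univ_mem h A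
      exact Set.eq_univ_of_forall fun _ => hP
    · convert IsPositiveCVariety.empty_mem h A
      exact Set.eq_empty_of_forall_notMem fun _ => hP
  prod_mem M hM N hN A _ φ P hP := by
    have : φ ⁻¹' P = ⋃ p : P, ((MonoidHom.fst _ _).comp φ) ⁻¹' Set.Iic p.1.1 ∩
        ((MonoidHom.snd _ _).comp φ) ⁻¹' Set.Iic p.1.2 := by
      ext w
      simp only [Set.mem_preimage, Set.mem_iUnion, Set.mem_inter_iff, Set.mem_Iic]
      exact ⟨fun hw => ⟨⟨_, hw⟩, le_rfl, le_rfl⟩, fun ⟨p, h₁, h₂⟩ => hP ⟨h₁, h₂⟩ p.2⟩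
    rw [this]
    exact IsPositiveCVariety.iUnion_mem h fun p => IsPositiveCVariety.inter_mem h A _
      (hM A _ _ (isLowerSet_Iic _)) _ (hN A _ _ (isLowerSet_Iic _))
  divides_mem M N hN hMN A _ φ P hP := by
    obtain ⟨S, f, hf, hmono⟩ := hMN
    obtain ⟨χ, rfl⟩ := exists_lift_of_surjective f hf φ
    convert hN A (S.subtype.comp χ) {n | ∃ s : S, f s ∈ P ∧ n ≤ s}
      (fun a b hba ⟨s, hs, has⟩ => ⟨s, hs, hba.trans has⟩) using 1
    ext w
    exact ⟨fun hw => ⟨χ w, hw, le_rfl⟩, fun ⟨s, hs, hws⟩ => hP (hmono hws) hs⟩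

theorem languagesOfOrd_ordMonoidsOf (h : IsPositiveVariety 𝒱) :
    languagesOfOrd (ordMonoidsOf 𝒱) = 𝒱 := by
  ext A _ L
  constructor
  · rintro ⟨-, _, hL⟩
    have := hL A (syntacticHom L) _ (isLowerSet_image_syntacticHom L)
    rwa [preimage_image_syntacticHom] at this
  · intro hL
    have hr := 𝒱.regular A L hL
    refine ⟨hr, hr.finite_synt, fun B _ φ P hP => ?_⟩
    obtain ⟨ψ, rfl⟩ := exists_lift_of_surjective _ (syntacticHom_surjective L) φ
    exact IsPositiveCVariety.preimage_mem h B A ψ trivial _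
      (IsPositiveCVariety.preimage_lowerSet_mem h hL hP)

end IsPositiveVariety

theorem bijOn_languagesOfOrd :
    Set.BijOn languagesOfOrd {V : Set FinOrdMonoid.{u} | IsOrdPseudovariety V}
      {𝒱 | IsPositiveVariety 𝒱} :=
  ⟨fun _ hV => hV.isPositiveVariety_languagesOfOrd,
    fun _ hV _ hW h => Set.Subset.antisymm (hW.subset_of_languagesOfOrd_eq hV h)
      (hV.subset_of_languagesOfOrd_eq hW h.symm),
    fun _ h => ⟨_, h.isOrdPseudovariety_ordMonoidsOf, h.languagesOfOrd_ordMonoidsOf⟩⟩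

theorem isOrdPseudovariety_ordDefinedBy (E : Set ProfiniteIdentity.{u}) :
    IsOrdPseudovariety (ordDefinedBy E) where
  trivial_mem _ _ _ := le_of_eq (Subsingleton.elim (α := PUnit) _ _)
  prod_mem M hM N hN e he φ := by
    have h₁ := hM e he ((MonoidHom.fst _ _).comp φ)
    have h₂ := hN e he ((MonoidHom.snd _ _).comp φ)
    rw [hat_comp, hat_comp] at h₁ h₂
    exact ⟨h₁, h₂⟩
  divides_mem M N hN h e he φ := by
    obtain ⟨S, f, hf, hmono⟩ := h
    obtain ⟨χ, rfl⟩ := exists_lift_of_surjective f hf φ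
    rw [hat_comp, hat_comp]
    have := hN e he (S.subtype.comp χ)
    rw [hat_comp, hat_comp] at this
    exact hmono this

theorem IsOrdPseudovariety.exists_eq_ordDefinedBy {V : Set FinOrdMonoid.{u}}
    (hV : IsOrdPseudovariety V) : ∃ E, V = ordDefinedBy E := by
  refine ⟨{e | ∀ N ∈ V, N.Satisfies e}, ?_⟩
  refine Set.Subset.antisymm (fun M hM e he => he M hM) fun M hM => ?_
  by_contra hn
  let ι := Σ N : {N // N ∈ V}, FreeMonoid M.carrier →* N.1.carrier
  have : Nonempty ι := ⟨⟨⟨_, hV.trivial_mem⟩, 1⟩⟩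
  obtain ⟨⟨x, y⟩, hxy⟩ := exists_common_pair
    (fun (i : ι) p => hat i.2 p.1 ≤ hat i.2 p.2 ∧
      ¬ hat (evalHom M.carrier) p.1 ≤ hat (evalHom M.carrier) p.2)
    (fun i => by
      have h₁ := isLocallyConstant_hat i.2
      have h₂ := isLocallyConstant_hat (evalHom M.carrier)
      exact ((h₁.comp_continuous continuous_fst).comp₂ (h₁.comp_continuous continuous_snd)
        (· ≤ ·)).comp₂ ((h₂.comp_continuous continuous_fst).comp₂
          (h₂.comp_continuous continuous_snd) (¬ · ≤ ·)) (· ∧ ·))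
    (fun i => by
      by_contra! hne
      refine hn (hV.divides_mem _ _ i.1.2 (FinOrdMonoid.divides_of_le i.2 (evalHom M.carrier)
        (evalHom_surjective _) fun v w hvw => ?_))
      have := hne ((v : FreeProfinite M.carrier), (w : FreeProfinite M.carrier))
      simp only [hat_coe] at this
      exact this hvw)
    (fun i j => ⟨⟨⟨_, hV.prod_mem _ i.1.2 _ j.1.2⟩, i.2.prod j.2⟩, fun p hp =>
      ⟨⟨hat_le_hat_of_le (by intro v w hvw; exact hvw.1) hp.1, hp.2⟩,
       ⟨hat_le_hat_of_le (by intro v w hvw; exact hvw.2) hp.1, hp.2⟩⟩⟩)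
  exact (hxy this.some).2 (hM ⟨M.carrier, x, y⟩ (fun N hN φ => (hxy ⟨⟨N, hN⟩, φ⟩).1) _)

theorem isOrdPseudovariety_iff (V : Set FinOrdMonoid.{u}) :
    IsOrdPseudovariety V ↔ ∃ E, V = ordDefinedBy E :=
  ⟨fun hV => hV.exists_eq_ordDefinedBy, fun ⟨E, hE⟩ => hE ▸ isOrdPseudovariety_ordDefinedBy E⟩

end Eilenberg

theorem theorem2p15 :
    -- Eilenberg's theorem
    (Set.BijOn languagesOf {V : Set FinMonoid.{u} | IsPseudovariety V} {𝒱 | IsVariety 𝒱} ∧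
      (∀ C : MorphismClass.{u}, C.IsAdmissible →
        Set.BijOn languagesOfStamps {V | IsCPseudovariety C V} {𝒱 | IsCVariety C 𝒱}) ∧
      Set.BijOn languagesOfOrd {V : Set FinOrdMonoid.{u} | IsOrdPseudovariety V}
        {𝒱 | IsPositiveVariety 𝒱}) ∧
    -- Reiterman's theorem
    ((∀ V : Set FinMonoid.{u}, IsPseudovariety V ↔ ∃ E, V = definedBy E) ∧
      (∀ C : MorphismClass.{u}, C.IsAdmissible →
        ∀ V : StampClass.{u}, IsCPseudovariety C V ↔ ∃ E, V = cDefinedBy C E) ∧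
      (∀ V : Set FinOrdMonoid.{u}, IsOrdPseudovariety V ↔ ∃ E, V = ordDefinedBy E)) := by
  exact ⟨⟨bijOn_languagesOf, fun _ hC => bijOn_languagesOfStamps hC, bijOn_languagesOfOrd⟩,
    isPseudovariety_iff, fun _ hC => isCPseudovariety_iff hC, isOrdPseudovariety_iff⟩
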